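/- Let $G=(V,E)$ be a finite digraph with nonempty vertex set $V=\{v_1,\dots,v_n\}$, in which self-loops and multiple arcs are allowed, and suppose that $G$ has no sinks (every vertex has at least one outgoing arc). Let $A$ be the adjacency matrix of $G$, whose $(i,j)$ entry is the number of arcs from $v_i$ to $v_j$, let $\rho(G)$ be the spectral radius of $A$ (the largest modulus of a complex eigenvalue), and for $k\ge 0$ let $d_i^{k+}$ be the $i$-th row sum of $A^k$, i.e. the number of directed walks of length $k$ starting at $v_i$ (so $d_i^{0+}=1$). Then for all integers $N\ge 0$ and $k\ge 0$, $$ \min_{(v_i,v_j)\in E}\left(\frac{d_i^{(k+1)+}\,d_j^{(k+N)+}}{d_i^{k+}\,d_j^{k+}}\right)^{\frac1{N+1}}\;\le\;\rho(G)\;\le\;\max_{(v_i,v_j)\in E}\left(\frac{d_i^{(k+1)+}\,d_j^{(k+N)+}}{d_i^{k+}\,d_j^{k+}}\right)^{\frac1{N+1}} . $$ Suppose moreover that $G$ is strongly connected, let $h(G)$ be its index of imprimitivity, i.e. the number of eigenvalues of $A$ of modulus $\rho(G)$, and put $r=\gcd(N+1,h(G))$. Then equality holds in the left inequality if and only if at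 least one of the following two conditions holds, and likewise equality holds in the right inequality if and only if at least one of them holds: 1. $G$ is average $(k+1)$-outdegree regular: there is a constant $c$ with $d_i^{(k+1)+}/d_i^{k+}=c$ for all $v_i\in V$; 2. $G$ is average $(k+1)$-outdegree $r$-quasiregular: $r>1$, $r$ divides $h(G)$, and there are a partition $V=V_1\cup\dots\cup V_r$ into nonempty classes such that every arc starting in $V_\ell$ ends in $V_{\ell+1}$ (indices modulo $r$), and constants $c_1,\dots,c_r$, such that $d_i^{(k+1)+}/d_i^{k+}=c_\ell$ for all $v_i\in V_\ell$ and all $\ell$. -/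

import Mathlib

open Quiver

/-! A digraph with self-loops and multiarcs allowed is a quiver: `i ⟶ j` is the type of arcs with
initial vertex `i` and terminal vertex `j`. -/

namespace MultiDigraph

/-- The adjacency matrix: the `(i, j)` entry is the number of arcs from `i` to `j`. -/
def adjMatrix (R : Type*) [NatCast R] (V : Type*) [Quiver V] [∀ i j : V, Fintype (i ⟶ j)] :
    Matrix V V R :=
  Matrix.of fun i j => (Fintype.card (i ⟶ j) : R)

/-- A sink is a vertex with no outgoing arcs. -/
def IsSink {V : Type*} [Quiver V] (i : V) : Prop :=
  ∀ j : V, IsEmpty (i ⟶ j)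

section

variable (V : Type*) [Fintype V] [DecidableEq V] [Quiver V] [∀ i j : V, Fintype (i ⟶ j)]

/-- The spectral radius of the digraph: the largest modulus of an eigenvalue of its adjacency
matrix. -/
noncomputable def rho : ℝ :=
  (spectralRadius ℂ (adjMatrix ℂ V)).toReal

/-- The index of imprimitivity (used for strongly connected digraphs): the number of eigenvalues
of the adjacency matrix whose modulus equals the spectral radius. -/
noncomputable def imprimitivityIndex : ℕ :=
  {z : ℂ | z ∈ spectrum ℂ (adjMatrix ℂ V) ∧ ‖z‖ = rho V}.ncard

/-- The `k`-outdegree of `i`: the `i`-th row sum of the `k`-th power of the adjacency matrix, that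
is, the number of directed walks of length `k` with initial vertex `i` (and `1` for `k = 0`). -/
def kOutdegree {V : Type*} [Fintype V] [DecidableEq V] [Quiver V] [∀ i j : V, Fintype (i ⟶ j)]
    (k : ℕ) (i : V) : ℕ :=
  ∑ j, (adjMatrix ℕ V ^ k) i j

/-- Average `κ`-outdegree regular, for `κ ≥ 1`. -/
def IsAvgOutdegreeRegular (κ : ℕ) : Prop :=
  1 ≤ κ ∧ ∃ c : ℝ, ∀ i : V, (kOutdegree κ i : ℝ) / (kOutdegree (κ - 1) i : ℝ) = c

/-- Cyclically `r`-partite. -/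
def IsCyclicallyPartite (r : ℕ) : Prop :=
  1 < r ∧ r ∣ imprimitivityIndex V

/-- The fibres of `m` are `r` nonempty classes, indexed cyclically, such that every arc leads from
its class to the next one: the partition that puts the adjacency matrix into `r`-cyclic form. -/
def IsCyclicPartition {V : Type*} [Quiver V] (r : ℕ) (m : V → ZMod r) : Prop :=
  Function.Surjective m ∧ ∀ i j : V, Nonempty (i ⟶ j) → m j = m i + 1

/-- Average `κ`-outdegree `r`-quasiregular, for `κ ≥ 1`. -/
def IsAvgOutdegreeQuasiregular (κ r : ℕ) : Prop :=
  1 ≤ κ ∧ IsCyclicallyPartite V r ∧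
    ∃ m : V → ZMod r, IsCyclicPartition r m ∧
      ∃ c : ZMod r → ℝ, ∀ i : V,
        (kOutdegree κ i : ℝ) / (kOutdegree (κ - 1) i : ℝ) = c (m i)

/-- The values over all arcs `(i, j)` of
`(d_i^{(k+1)+} d_j^{(k+N)+} / (d_i^{k+} d_j^{k+})) ^ (1 / (N + 1))`. -/
def arcValues (k N : ℕ) : Set ℝ :=
  {x : ℝ | ∃ i j : V, Nonempty (i ⟶ j) ∧
    x = (((kOutdegree (k + 1) i : ℝ) * (kOutdegree (k + N) j : ℝ)) /
      ((kOutdegree k i : ℝ) * (kOutdegree k j : ℝ))) ^ (1 / ((N : ℝ) + 1))}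

end

end MultiDigraph

/-!
Let `A` be the adjacency matrix, `d` the vector of `k`-outdegrees and `ρ` the spectral radius.
Row `i` of `A ^ (N + 1) d` is `∑ⱼ aᵢⱼ dⱼ^{(k+N)+}`, and if each arc value to the power `N + 1` is at
most `m`, then each summand is at most `m aᵢⱼ dᵢ dⱼ / dᵢ^{(k+1)+}`; summing over `j` gives
`A ^ (N + 1) d ≤ m d`. The same holds with `≥`. As `d` is positive, the Collatz–Wielandt bounds
(`spectralRadius_le_of_mulVec_le`, `le_spectralRadius_of_le_mulVec`) compare `ρ ^ (N + 1)` with `m`,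
which proves the two inequalities.

Suppose now that the digraph is strongly connected. There is a positive vector `x` with `A x = ρ x`
(`exists_perron_vector`), and the minimum principle `eq_smul_of_mulVec_le` says that `A g ≤ ρ g`
forces `g` to be a multiple of `x`. If equality holds in one of the bounds, `d` is superharmonic or
subharmonic for `A ^ (N + 1)`, and the minimum principle, applied to `∑_{l ≤ N} ρ⁻ˡ A ^ l d`, shows
that `A ^ (N + 1) d = ρ ^ (N + 1) d` (`pow_mulVec_eq_of_le`). Hence `d` is a sum of eigenvectors of
`A` for eigenvalues `ρ ω` with `ω ^ (N + 1) = 1`. By `phase_of_mulVec_eq`, such an eigenvector,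
divided by `x`, is multiplied by `ω` along every arc. The `ω` that admit a nonzero function with
this property form a finite group `phaseGroup A`; it corresponds to the eigenvalues of maximal
modulus (`peripheral_eq_image`), so it consists of the `h`-th roots of unity, where `h` is the index of
imprimitivity. Hence only the `ω` with `ω ^ r = 1` occur, `r = gcd (N + 1) h`. A function that is
multiplied along arcs by a primitive `r`-th root of unity sorts the vertices into `r` cyclic
classes, and `d / x` is constant on each of them (`exists_cyclic_map_of_pow_mulVec_eq`); so the
average outdegrees are constant on the classes as well.

Conversely, if the average outdegrees are constants on `r` cyclic classes with `r ∣ N + 1`, then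
every arc value is the `(N + 1)`-th root of the same product of these constants
(`arcValues_subsingleton`), so that the least and the greatest arc value coincide and enclose `ρ`.
-/

namespace MultiDigraph

variable {V : Type*} [Fintype V] [DecidableEq V]

/-! ### Spectra of complex matrices -/

section Spectrum

/- Gelfand's formula needs some submultiplicative norm on matrices; the spectral radius does not
depend on it. -/
attribute [local instance] Matrix.linftyOpNormedRing Matrix.linftyOpNormedAlgebra

theorem exists_mem_spectrum_norm_eq [Nonempty V] (M : Matrix V V ℂ) :
    ∃ z ∈ spectrum ℂ M, ‖z‖ = (spectralRadius ℂ M).toReal := by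
  obtain ⟨z, hz, h⟩ := spectrum.exists_nnnorm_eq_spectralRadius M
  exact ⟨z, hz, by rw [← h]; simp⟩

theorem norm_le_of_mem_spectrum (M : Matrix V V ℂ) {z : ℂ} (hz : z ∈ spectrum ℂ M) :
    ‖z‖ ≤ (spectralRadius ℂ M).toReal := by
  have : Nonempty V := by
    by_contra hV
    rw [not_nonempty_iff] at hV
    simp [spectrum.of_subsingleton] at hz
  have h : (‖z‖₊ : ENNReal) ≤ spectralRadius ℂ M := le_iSup₂ (α := ENNReal) z hz
  obtain ⟨w, -, hw⟩ := spectrum.exists_nnnorm_eq_spectralRadius M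
  rw [← hw] at h ⊢
  simpa [← NNReal.coe_le_coe] using h

theorem mem_spectrum_iff_exists_mulVec (M : Matrix V V ℂ) (z : ℂ) :
    z ∈ spectrum ℂ M ↔ ∃ v : V → ℂ, v ≠ 0 ∧ M.mulVec v = z • v := by
  rw [← Matrix.spectrum_toLin', ← Module.End.hasEigenvalue_iff_mem_spectrum]
  constructor
  · intro h
    obtain ⟨v, hv⟩ := h.exists_hasEigenvector
    exact ⟨v, hv.2, by simpa using hv.apply_eq_smul⟩
  · rintro ⟨v, hv, h⟩
    exact Module.End.hasEigenvalue_of_hasEigenvector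
      ⟨Module.End.mem_eigenspace_iff.2 (by simpa using h), hv⟩

theorem toReal_spectralRadius_pow [Nonempty V] (M : Matrix V V ℂ) {n : ℕ} (hn : 0 < n) :
    (spectralRadius ℂ (M ^ n)).toReal = (spectralRadius ℂ M).toReal ^ n := by
  apply le_antisymm
  · obtain ⟨z, hz, h⟩ := exists_mem_spectrum_norm_eq (M ^ n)
    rw [spectrum.map_pow_of_pos M hn] at hz
    obtain ⟨w, hw, rfl⟩ := hz
    rw [← h, norm_pow]
    gcongr
    exact norm_le_of_mem_spectrum M hw
  · obtain ⟨z, hz, h⟩ := exists_mem_spectrum_norm_eq M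
    rw [← h, ← norm_pow]
    apply norm_le_of_mem_spectrum
    rw [spectrum.map_pow_of_pos M hn]
    exact ⟨z, hz, rfl⟩

/-- Gelfand's formula, as a limit of real numbers. -/
theorem tendsto_norm_pow_toReal_spectralRadius [Nonempty V] (M : Matrix V V ℂ) :
    Filter.Tendsto (fun n : ℕ => ‖M ^ n‖ ^ (1 / n : ℝ)) Filter.atTop
      (nhds (spectralRadius ℂ M).toReal) := by
  have hfin : spectralRadius ℂ M ≠ ⊤ := by
    obtain ⟨w, -, hw⟩ := spectrum.exists_nnnorm_eq_spectralRadius M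
    rw [← hw]; simp
  refine ((ENNReal.tendsto_toReal hfin).comp
    (spectrum.pow_norm_pow_one_div_tendsto_nhds_spectralRadius M)).congr fun n => ?_
  exact ENNReal.toReal_ofReal (by positivity)

/-! ### Collatz–Wielandt bounds -/

omit [DecidableEq V] in
theorem map_mulVec_ofReal (C : Matrix V V ℝ) (d : V → ℝ) :
    (C.map (algebraMap ℝ ℂ)).mulVec (fun i => (d i : ℂ)) = fun i => ((C.mulVec d i : ℝ) : ℂ) := by
  ext i
  simp [Matrix.mulVec, dotProduct]

omit [DecidableEq V] in
theorem mulVec_mono {C : Matrix V V ℝ} (hC : ∀ i j, 0 ≤ C i j) {u v : V → ℝ}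
    (h : ∀ i, u i ≤ v i) (i : V) : C.mulVec u i ≤ C.mulVec v i :=
  Finset.sum_le_sum fun j _ => mul_le_mul_of_nonneg_left (h j) (hC i j)

/-- The lower Collatz–Wielandt bound. Iteration gives `C ^ n d ≥ m ^ n d`, so that `‖C ^ n‖` is at
least a constant times `m ^ n`, and Gelfand's formula applies. -/
theorem le_spectralRadius_of_le_mulVec {C : Matrix V V ℝ} (hC : ∀ i j, 0 ≤ C i j) {d : V → ℝ}
    {i : V} (hd : 0 < d i) {m : ℝ} (hm : 0 ≤ m) (h : ∀ j, m * d j ≤ C.mulVec d j) :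
    m ≤ (spectralRadius ℂ (C.map (algebraMap ℝ ℂ))).toReal := by
  have : Nonempty V := ⟨i⟩
  have hiter : ∀ n : ℕ, ∀ j, m ^ n * d j ≤ (C ^ n).mulVec d j := by
    intro n
    induction n with
    | zero => intro j; simp
    | succ n ih =>
      intro j
      rw [pow_succ' C, ← Matrix.mulVec_mulVec]
      refine le_trans ?_ (mulVec_mono hC ih j)
      have : C.mulVec (fun j => m ^ n * d j) j = m ^ n * C.mulVec d j := by
        have := congrFun (Matrix.mulVec_smul C (m ^ n) d) j
        simpa [Pi.smul_def] using this
      rw [this, pow_succ, mul_assoc]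
      exact mul_le_mul_of_nonneg_left (h j) (by positivity)
  set D : V → ℂ := fun i => (d i : ℂ) with hD
  have hDi : ‖D i‖ = d i := by simp [hD, abs_of_pos hd]
  have hDpos : 0 < ‖D‖ := lt_of_lt_of_le (by rwa [hDi]) (norm_le_pi_norm D i)
  have hbound : ∀ n : ℕ, m ^ n * (d i / ‖D‖) ≤ ‖(C.map (algebraMap ℝ ℂ)) ^ n‖ := by
    intro n
    rw [← mul_div_assoc, div_le_iff₀ hDpos]
    refine le_trans ?_ (Matrix.linfty_opNorm_mulVec _ _)
    refine le_trans ?_ (norm_le_pi_norm _ i)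
    rw [← Matrix.map_pow, hD, map_mulVec_ofReal, Complex.norm_real]
    exact (hiter n i).trans (le_abs_self _)
  have hδ : 0 < d i / ‖D‖ := by positivity
  have hlim : Filter.Tendsto (fun n : ℕ => m * (d i / ‖D‖) ^ (1 / n : ℝ)) Filter.atTop
      (nhds m) := by
    have h1 := (tendsto_one_div_atTop_nhds_zero_nat (𝕜 := ℝ))
    have h2 := (Real.continuousAt_const_rpow hδ.ne' (b := 0)).tendsto.comp h1
    simpa using h2.const_mul m
  refine le_of_tendsto_of_tendsto hlim (tendsto_norm_pow_toReal_spectralRadius _) ?_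
  filter_upwards [Filter.eventually_gt_atTop 0] with n hn
  calc m * (d i / ‖D‖) ^ (1 / n : ℝ) = (m ^ n * (d i / ‖D‖)) ^ (1 / n : ℝ) := by
        rw [Real.mul_rpow (by positivity) hδ.le, one_div, Real.pow_rpow_inv_natCast hm hn.ne']
    _ ≤ _ := Real.rpow_le_rpow (by positivity) (hbound n) (by positivity)

omit [DecidableEq V] in
/-- If `C z = μ z` for a nonnegative matrix `C`, then `|μ| |z| ≤ C |z|` entrywise. -/
theorem norm_mul_norm_le_mulVec_norm {C : Matrix V V ℝ} (hC : ∀ i j, 0 ≤ C i j) {z : V → ℂ} {μ : ℂ}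
    (h : (C.map (algebraMap ℝ ℂ)).mulVec z = μ • z) (i : V) :
    ‖μ‖ * ‖z i‖ ≤ C.mulVec (fun j => ‖z j‖) i := by
  have h1 := congrFun h i
  rw [Pi.smul_apply, smul_eq_mul] at h1
  rw [← norm_mul, ← h1]
  refine (norm_sum_le _ _).trans (Finset.sum_le_sum fun j _ => ?_)
  simp [abs_of_nonneg (hC i j)]

/-- The upper Collatz–Wielandt bound: an eigenvector for a dominant eigenvalue is compared with
`d` at an index where the quotient of the two is largest in modulus. -/
theorem spectralRadius_le_of_mulVec_le [Nonempty V] {C : Matrix V V ℝ} (hC : ∀ i j, 0 ≤ C i j)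
    {d : V → ℝ} (hd : ∀ i, 0 < d i) {m : ℝ} (h : ∀ j, C.mulVec d j ≤ m * d j) :
    (spectralRadius ℂ (C.map (algebraMap ℝ ℂ))).toReal ≤ m := by
  obtain ⟨μ, hμ, hμn⟩ := exists_mem_spectrum_norm_eq (C.map (algebraMap ℝ ℂ))
  rw [← hμn]
  obtain ⟨z, hz0, hz⟩ := (mem_spectrum_iff_exists_mulVec _ _).1 hμ
  obtain ⟨i, hi⟩ := Finite.exists_max fun j => ‖z j‖ / d j
  set c := ‖z i‖ / d i with hc
  have hzle : ∀ j, ‖z j‖ ≤ c * d j := fun j => (div_le_iff₀ (hd j)).1 (hi j)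
  have hcpos : 0 < c := by
    obtain ⟨j, hj⟩ := Function.ne_iff.1 hz0
    exact (div_pos (norm_pos_iff.2 hj) (hd j)).trans_le (hi j)
  have hzi : ‖z i‖ = c * d i := by rw [hc, div_mul_cancel₀ _ (hd i).ne']
  have h1 : ‖μ‖ * (c * d i) ≤ m * (c * d i) := by
    calc ‖μ‖ * (c * d i) ≤ C.mulVec (fun j => ‖z j‖) i := hzi ▸ norm_mul_norm_le_mulVec_norm hC hz i
      _ ≤ C.mulVec (c • d) i := mulVec_mono hC hzle i
      _ = c * C.mulVec d i := by rw [Matrix.mulVec_smul]; rfl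
      _ ≤ c * (m * d i) := mul_le_mul_of_nonneg_left (h i) hcpos.le
      _ = _ := by ring
  exact le_of_mul_le_mul_right h1 (mul_pos hcpos (hd i))

end Spectrum

/-! ### Perron vectors of irreducible matrices -/

/-- The spectral radius of a real matrix, as a real number. -/
noncomputable def specRad (A : Matrix V V ℝ) : ℝ :=
  (spectralRadius ℂ (A.map (algebraMap ℝ ℂ))).toReal

theorem specRad_nonneg (A : Matrix V V ℝ) : 0 ≤ specRad A := ENNReal.toReal_nonneg

theorem specRad_pow [Nonempty V] (A : Matrix V V ℝ) {n : ℕ} (hn : 0 < n) :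
    specRad (A ^ n) = specRad A ^ n := by
  rw [specRad, specRad, Matrix.map_pow, toReal_spectralRadius_pow _ hn]

/-- The index `j` is reachable from `i` along positive entries of `A`. -/
abbrev Reach (A : Matrix V V ℝ) (i j : V) : Prop :=
  Relation.ReflTransGen (fun a b => 0 < A a b) i j

/-- A polynomial in `A`, namely a sum of powers of `A`, with all entries positive. -/
theorem exists_sum_pow_pos {A : Matrix V V ℝ} (hA : ∀ i j, 0 ≤ A i j)
    (hirr : ∀ i j, Reach A i j) :
    ∃ e : V → V → ℕ, ∀ i j, 0 < (∑ a, ∑ b, A ^ e a b) i j := by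
  have hpow : ∀ i j, ∃ k, 0 < (A ^ k) i j := by
    intro i j
    induction hirr i j with
    | refl => exact ⟨0, by simp⟩
    | @tail b c _ hbc ih =>
      obtain ⟨k, hk⟩ := ih
      refine ⟨k + 1, ?_⟩
      rw [pow_succ, Matrix.mul_apply]
      exact Finset.sum_pos' (fun l _ => mul_nonneg (Matrix.pow_apply_nonneg hA k i l) (hA l c))
        ⟨b, Finset.mem_univ b, mul_pos hk hbc⟩
  choose e he using hpow
  refine ⟨e, fun i j => ?_⟩
  simp only [Matrix.sum_apply]
  have hnn : ∀ a b, 0 ≤ (A ^ e a b) i j := fun a b => Matrix.pow_apply_nonneg hA _ i j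
  exact Finset.sum_pos' (fun a _ => Finset.sum_nonneg fun b _ => hnn a b)
    ⟨i, Finset.mem_univ i, Finset.sum_pos' (fun b _ => hnn i b) ⟨j, Finset.mem_univ j, he i j⟩⟩

omit [DecidableEq V] in
theorem mulVec_pos_of_pos {P : Matrix V V ℝ} (hP : ∀ i j, 0 < P i j) {u : V → ℝ}
    (hu : ∀ i, 0 ≤ u i) (hu0 : u ≠ 0) (i : V) : 0 < P.mulVec u i := by
  obtain ⟨j, hj⟩ := Function.ne_iff.1 hu0
  exact Finset.sum_pos' (fun l _ => mul_nonneg (hP i l).le (hu l))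
    ⟨j, Finset.mem_univ j, mul_pos (hP i j) ((hu j).lt_of_ne' hj)⟩

theorem pow_mulVec_of_mulVec_eq {R : Type*} [CommRing R] {A : Matrix V V R} {w : V → R} {r : R}
    (h : A.mulVec w = r • w) (n : ℕ) : (A ^ n).mulVec w = r ^ n • w := by
  induction n with
  | zero => simp
  | succ n ih =>
    rw [pow_succ, ← Matrix.mulVec_mulVec, h, Matrix.mulVec_smul, ih, smul_smul, pow_succ, mul_comm]

/-- A nonzero nonnegative subharmonic vector, `ρ w ≤ A w`, is a positive eigenvector. Otherwise a
positive polynomial in `A`, applied to it, gives a positive `v` with `A v > ρ v` at all indices,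
which contradicts the lower Collatz–Wielandt bound. -/
theorem mulVec_eq_and_pos_of_specRad_le {A : Matrix V V ℝ} (hA : ∀ i j, 0 ≤ A i j)
    (hirr : ∀ i j, Reach A i j) {w : V → ℝ} (hw : ∀ i, 0 ≤ w i) (hw0 : w ≠ 0)
    (h : ∀ i, specRad A * w i ≤ A.mulVec w i) :
    A.mulVec w = specRad A • w ∧ ∀ i, 0 < w i := by
  obtain ⟨e, he⟩ := exists_sum_pow_pos hA hirr
  set P := ∑ a, ∑ b, A ^ e a b with hPdef
  have hcomm : Commute A P :=
    Commute.sum_right _ _ _ fun a _ => Commute.sum_right _ _ _ fun b _ => Commute.self_pow A _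
  set ρ := specRad A with hρ
  have heq : A.mulVec w = ρ • w := by
    by_contra hne
    have hu0 : A.mulVec w - ρ • w ≠ 0 := sub_ne_zero.2 hne
    have hPu := mulVec_pos_of_pos he (u := A.mulVec w - ρ • w)
      (fun i => sub_nonneg.2 (h i)) hu0
    have hv := mulVec_pos_of_pos he hw hw0
    have hAv : ∀ i, A.mulVec (P.mulVec w) i
        = ρ * P.mulVec w i + P.mulVec (A.mulVec w - ρ • w) i := by
      intro i
      have h1 : A.mulVec (P.mulVec w) = P.mulVec (A.mulVec w) := by
        rw [Matrix.mulVec_mulVec, hcomm.eq, Matrix.mulVec_mulVec]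
      rw [h1, Matrix.mulVec_sub, Matrix.mulVec_smul]
      simp
    obtain ⟨i₀, -⟩ := Function.ne_iff.1 hw0
    have : Nonempty V := ⟨i₀⟩
    obtain ⟨i, hi⟩ := Finite.exists_min fun i =>
      P.mulVec (A.mulVec w - ρ • w) i / P.mulVec w i
    set ε := P.mulVec (A.mulVec w - ρ • w) i / P.mulVec w i with hε
    have hεpos : 0 < ε := div_pos (hPu i) (hv i)
    have hle : ρ + ε ≤ ρ := by
      refine le_spectralRadius_of_le_mulVec hA (hv i₀)
        (add_nonneg (specRad_nonneg A) hεpos.le) fun j => ?_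
      rw [hAv, add_mul]
      exact add_le_add le_rfl ((le_div_iff₀ (hv j)).1 (hi j))
    linarith
  -- `P w` is a multiple of `w`, and it is positive.
  refine ⟨heq, fun i => (hw i).lt_of_ne' fun hi => ?_⟩
  have h1 := mulVec_pos_of_pos he hw hw0 i
  simp [hPdef, Matrix.sum_mulVec, pow_mulVec_of_mulVec_eq heq, hi] at h1

/-- Existence of a Perron vector: the entrywise modulus of an eigenvector for a dominant
eigenvalue. -/
theorem exists_perron_vector [Nonempty V] {A : Matrix V V ℝ} (hA : ∀ i j, 0 ≤ A i j)
    (hirr : ∀ i j, Reach A i j) :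
    ∃ x : V → ℝ, (∀ i, 0 < x i) ∧ A.mulVec x = specRad A • x := by
  obtain ⟨μ, hμ, hμn⟩ := exists_mem_spectrum_norm_eq (A.map (algebraMap ℝ ℂ))
  obtain ⟨z, hz0, hz⟩ := (mem_spectrum_iff_exists_mulVec _ _).1 hμ
  have hw0 : (fun i => ‖z i‖) ≠ 0 := by
    obtain ⟨j, hj⟩ := Function.ne_iff.1 hz0
    exact Function.ne_iff.2 ⟨j, norm_ne_zero_iff.2 hj⟩
  obtain ⟨h1, h2⟩ := mulVec_eq_and_pos_of_specRad_le hA hirr (fun i => norm_nonneg (z i)) hw0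
    (fun i => by rw [specRad, ← hμn]; exact norm_mul_norm_le_mulVec_norm hA hz i)
  exact ⟨_, h2, h1⟩

omit [DecidableEq V] in
/-- The minimum principle: a superharmonic vector, `A g ≤ ρ g`, is a multiple of the Perron vector
`x`. The smallest multiple `c x` touching `g` from below agrees with it at one index, hence at all
successors of that index. -/
theorem eq_smul_of_mulVec_le [Nonempty V] {A : Matrix V V ℝ} (hA : ∀ i j, 0 ≤ A i j)
    (hirr : ∀ i j, Reach A i j) {ρ : ℝ} {x : V → ℝ} (hx : ∀ i, 0 < x i)
    (hAx : A.mulVec x = ρ • x) {g : V → ℝ} (h : ∀ i, A.mulVec g i ≤ ρ * g i) :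
    ∃ c : ℝ, g = c • x := by
  obtain ⟨i₀, hi₀⟩ := Finite.exists_min fun i => g i / x i
  set c := g i₀ / x i₀ with hc
  have hge : ∀ i, 0 ≤ g i - c * x i := fun i => sub_nonneg.2 ((le_div_iff₀ (hx i)).1 (hi₀ i))
  have hsup : ∀ i, ∑ j, A i j * (g j - c * x j) ≤ ρ * (g i - c * x i) := by
    intro i
    have h1 : ∑ j, A i j * (g j - c * x j) = A.mulVec g i - c * A.mulVec x i := by
      simp only [Matrix.mulVec, dotProduct, Finset.mul_sum, ← Finset.sum_sub_distrib]
      exact Finset.sum_congr rfl fun j _ => by ring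
    rw [h1, hAx]
    simp only [Pi.smul_apply, smul_eq_mul]
    linarith [h i]
  refine ⟨c, funext fun j => ?_⟩
  have hzero : g j - c * x j = 0 := by
    induction hirr i₀ j with
    | refl => rw [hc, div_mul_cancel₀ _ (hx i₀).ne', sub_self]
    | @tail a b _ hab ih =>
      have h1 := hsup a
      rw [ih, mul_zero] at h1
      have h2 := Finset.single_le_sum (f := fun j => A a j * (g j - c * x j))
        (fun j _ => mul_nonneg (hA a j) (hge j)) (Finset.mem_univ b)
      have h3 : A a b * (g b - c * x b) = 0 :=
        le_antisymm (h2.trans h1) (mul_nonneg (hA a b) (hge b))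
      exact (mul_eq_zero.1 h3).resolve_left hab.ne'
  simpa [sub_eq_zero] using hzero

/-- The sum `∑_{l < n} μ⁻ˡ A ^ l v` is an eigenvector for `μ` up to the two end terms of a
telescoping sum. -/
theorem mulVec_sum_inv_pow_smul {K : Type*} [Field K] (A : Matrix V V K) {μ : K} (hμ : μ ≠ 0)
    (v : V → K) (n : ℕ) :
    A.mulVec (∑ l ∈ Finset.range n, (μ⁻¹) ^ l • (A ^ l).mulVec v) =
      μ • ((∑ l ∈ Finset.range n, (μ⁻¹) ^ l • (A ^ l).mulVec v) - v +
        (μ⁻¹) ^ n • (A ^ n).mulVec v) := by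
  have h1 : A.mulVec (∑ l ∈ Finset.range n, (μ⁻¹) ^ l • (A ^ l).mulVec v) =
      μ • ∑ l ∈ Finset.range n, (μ⁻¹) ^ (l + 1) • (A ^ (l + 1)).mulVec v := by
    rw [Matrix.mulVec_sum, Finset.smul_sum]
    refine Finset.sum_congr rfl fun l _ => ?_
    rw [Matrix.mulVec_smul, Matrix.mulVec_mulVec, ← pow_succ', smul_smul, pow_succ' μ⁻¹,
      mul_inv_cancel_left₀ hμ]
  have h2 := Finset.sum_range_succ (fun l => (μ⁻¹) ^ l • (A ^ l).mulVec v) n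
  rw [Finset.sum_range_succ'] at h2
  simp only [pow_zero, Matrix.one_mulVec, one_smul] at h2
  rw [h1, sub_add_eq_add_sub, ← h2, add_sub_cancel_right]

/-- Summation over the `n`-th roots of unity isolates the term of index `0`. -/
theorem sum_sum_inv_pow_mul {K : Type*} [Field K] {η : K} {n : ℕ} (hη : IsPrimitiveRoot η n)
    (hn : 0 < n) (ρ : K) (f : ℕ → K) :
    ∑ t ∈ Finset.range n, ∑ l ∈ Finset.range n, ((ρ * η ^ t)⁻¹) ^ l * f l = n * f 0 := by
  rw [Finset.sum_comm, Finset.sum_eq_single_of_mem 0 (Finset.mem_range.2 hn)]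
  · simp
  · intro l hl hl0
    have hξ1 : (η⁻¹) ^ l ≠ 1 := hη.inv.pow_ne_one_of_pos_of_lt hl0 (Finset.mem_range.1 hl)
    have hgeom : ∑ t ∈ Finset.range n, ((η⁻¹) ^ l) ^ t = 0 := by
      have h := geom_sum_mul ((η⁻¹) ^ l) n
      rw [← pow_mul, mul_comm l, pow_mul, hη.inv.pow_eq_one, one_pow, sub_self] at h
      exact (mul_eq_zero.1 h).resolve_right (sub_ne_zero.2 hξ1)
    have hterm : ∀ t, ((ρ * η ^ t)⁻¹) ^ l * f l = ((η⁻¹) ^ l) ^ t * ((ρ⁻¹) ^ l * f l) := by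
      intro t
      rw [mul_inv, mul_pow, ← inv_pow, ← pow_mul, mul_comm t, pow_mul]
      ring
    simp only [hterm, ← Finset.sum_mul, hgeom, zero_mul]

/-- If `d` is superharmonic for `A ^ (N + 1)`, then `∑_{l ≤ N} ρ⁻ˡ A ^ l d` is superharmonic for
`A`, hence harmonic, and so `d` is harmonic for `A ^ (N + 1)`. -/
theorem pow_mulVec_eq_of_le [Nonempty V] {A : Matrix V V ℝ} (hA : ∀ i j, 0 ≤ A i j)
    (hirr : ∀ i j, Reach A i j) {ρ : ℝ} (hρ : 0 < ρ) {x : V → ℝ} (hx : ∀ i, 0 < x i)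
    (hAx : A.mulVec x = ρ • x) {N : ℕ} {d : V → ℝ}
    (h : ∀ i, (A ^ (N + 1)).mulVec d i ≤ ρ ^ (N + 1) * d i) :
    (A ^ (N + 1)).mulVec d = ρ ^ (N + 1) • d := by
  set g : V → ℝ := ∑ l ∈ Finset.range (N + 1), (ρ⁻¹) ^ l • (A ^ l).mulVec d with hg
  have hAg := mulVec_sum_inv_pow_smul A hρ.ne' d (N + 1)
  rw [← hg] at hAg
  have hle : ∀ i, A.mulVec g i ≤ ρ * g i := by
    intro i
    rw [hAg]
    simp only [Pi.smul_apply, Pi.add_apply, Pi.sub_apply, smul_eq_mul]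
    refine mul_le_mul_of_nonneg_left ?_ hρ.le
    have : (ρ⁻¹) ^ (N + 1) * (A ^ (N + 1)).mulVec d i ≤ d i := by
      rw [inv_pow, inv_mul_le_iff₀ (by positivity)]
      exact h i
    linarith
  obtain ⟨c, hc⟩ := eq_smul_of_mulVec_le hA hirr hx hAx hle
  have h3 : A.mulVec g = ρ • g := by
    rw [hc, Matrix.mulVec_smul, hAx, smul_comm]
  rw [h3] at hAg
  have h4 := smul_right_injective (V → ℝ) hρ.ne' hAg
  have h5 : (ρ⁻¹) ^ (N + 1) • (A ^ (N + 1)).mulVec d = d := by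
    have : g = g + ((ρ⁻¹) ^ (N + 1) • (A ^ (N + 1)).mulVec d - d) := by
      nth_rewrite 1 [h4]; abel
    exact sub_eq_zero.1 (left_eq_add.1 this)
  nth_rewrite 2 [← h5]
  rw [smul_smul, ← mul_pow, mul_inv_cancel₀ hρ.ne', one_pow, one_smul]

omit [DecidableEq V] in
/-- An eigenvector for `ρ ω`, where `|ω| = 1`, is multiplied by `ω` along each positive entry, up
to the Perron vector: its modulus is subharmonic, hence proportional to `x`, and equality holds
in the triangle inequality at each index. -/
theorem phase_of_mulVec_eq [Nonempty V] {A : Matrix V V ℝ} (hA : ∀ i j, 0 ≤ A i j)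
    (hirr : ∀ i j, Reach A i j) {ρ : ℝ} (hρ : 0 < ρ) {x : V → ℝ} (hx : ∀ i, 0 < x i)
    (hAx : A.mulVec x = ρ • x) {ω : ℂ} (hω : ‖ω‖ = 1) {z : V → ℂ}
    (hz : (A.map (algebraMap ℝ ℂ)).mulVec z = (ρ * ω) • z) {i j : V} (hij : 0 < A i j) :
    z j / x j = ω * (z i / x i) := by
  have hsub : ∀ i, A.mulVec (fun j => -‖z j‖) i ≤ ρ * -‖z i‖ := by
    intro i
    have h1 := norm_mul_norm_le_mulVec_norm hA hz i
    rw [norm_mul, hω, mul_one, Complex.norm_real, Real.norm_of_nonneg hρ.le] at h1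
    have h2 : A.mulVec (fun j => -‖z j‖) = -A.mulVec (fun j => ‖z j‖) :=
      Matrix.mulVec_neg _ A
    rw [h2, Pi.neg_apply]
    linarith
  obtain ⟨c', hc'⟩ := eq_smul_of_mulVec_le hA hirr hx hAx hsub
  obtain ⟨c, hc⟩ : ∃ c : ℝ, ∀ j, ‖z j‖ = c * x j :=
    ⟨-c', fun j => by have := congrFun hc' j; simp only [Pi.smul_apply, smul_eq_mul] at this
                      linarith⟩
  -- Work with `y = z / x`, of constant modulus `c`.
  set y : V → ℂ := fun j => z j / x j with hy
  have hzy : ∀ j, z j = y j * x j := fun j => by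
    have : (x j : ℂ) ≠ 0 := by exact_mod_cast (hx j).ne'
    simp [hy, this]
  have hyn : ∀ j, ‖y j‖ = c := fun j => by
    rw [hy]; simp only [norm_div, hc, Complex.norm_real, Real.norm_of_nonneg (hx j).le]
    exact mul_div_cancel_right₀ _ (hx j).ne'
  have hsum : ∑ j, (A i j * x j : ℝ) * y j = ρ * x i * (ω * y i) := by
    have := congrFun hz i
    simp only [Matrix.mulVec, dotProduct, Matrix.map_apply, Pi.smul_apply, smul_eq_mul, hzy] at this
    rw [show (ρ * x i * (ω * y i) : ℂ) = ρ * ω * (y i * x i) by ring, ← this]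
    exact Finset.sum_congr rfl fun j _ => by simp; ring
  have hsumx : ∑ j, A i j * x j = ρ * x i := congrFun hAx i
  have hωy : ‖ω * y i‖ = c := by rw [norm_mul, hω, one_mul, hyn]
  -- The weighted average of the squared distances `|y j - ω y i|²` vanishes.
  have hdist : ∑ j, A i j * x j * ‖y j - ω * y i‖ ^ 2 = 0 := by
    have hexp : ∀ j, A i j * x j * ‖y j - ω * y i‖ ^ 2 = 2 * c ^ 2 * (A i j * x j)
        - 2 * (((A i j * x j : ℝ) * y j) * (starRingEnd ℂ) (ω * y i)).re := by
      intro j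
      rw [mul_assoc ((A i j * x j : ℝ) : ℂ), Complex.re_ofReal_mul, ← Complex.normSq_eq_norm_sq,
        Complex.normSq_sub, Complex.normSq_eq_norm_sq, Complex.normSq_eq_norm_sq, hyn, hωy]
      ring
    simp only [hexp, Finset.sum_sub_distrib, ← Finset.mul_sum, ← Complex.re_sum, ← Finset.sum_mul,
      hsum, hsumx]
    rw [mul_assoc _ (ω * y i), Complex.mul_conj, Complex.normSq_eq_norm_sq, hωy]
    have : ((ρ * x i * ((c ^ 2 : ℝ) : ℂ)) : ℂ).re = ρ * x i * c ^ 2 := by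
      rw [← Complex.ofReal_mul, ← Complex.ofReal_mul, Complex.ofReal_re]
    rw [this]
    ring
  have h0 := (Finset.sum_eq_zero_iff_of_nonneg fun j _ => mul_nonneg
    (mul_nonneg (hA i j) (hx j).le) (sq_nonneg _)).1 hdist j (Finset.mem_univ j)
  have h1 := (mul_eq_zero.1 h0).resolve_left (mul_pos hij (hx j)).ne'
  exact sub_eq_zero.1 (norm_eq_zero.1 (pow_eq_zero_iff (two_ne_zero)|>.1 h1))

/-! ### The group of peripheral phases -/

/-- The group of those `ω` for which some nowhere vanishing function on the indices is multiplied
by `ω` along every positive entry of `A`. For irreducible `A` these are the quotients by the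
spectral radius of the eigenvalues of maximal modulus. -/
def phaseGroup {V : Type*} (A : Matrix V V ℝ) : Subgroup ℂˣ where
  carrier := {ω | ∃ u : V → ℂˣ, ∀ i j, 0 < A i j → u j = ω * u i}
  mul_mem' := by
    rintro a b ⟨u, hu⟩ ⟨v, hv⟩
    exact ⟨u * v, fun i j h => by simp [hu i j h, hv i j h, mul_mul_mul_comm]⟩
  one_mem' := ⟨1, by simp⟩
  inv_mem' := by
    rintro a ⟨u, hu⟩
    exact ⟨u⁻¹, fun i j h => by simp [hu i j h, mul_comm]⟩

/-- A level function: `n j` is the length of some walk from `v` to `j`, so that anything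
multiplied by `ω` along positive entries takes the value `ω ^ n j` times its value at `v`. -/
theorem exists_level {V : Type*} {A : Matrix V V ℝ} (hirr : ∀ i j, Reach A i j) (v : V) :
    ∃ n : V → ℕ, ∀ (ω : ℂ) (y : V → ℂ), (∀ i j, 0 < A i j → y j = ω * y i) →
      ∀ j, y j = ω ^ n j * y v := by
  have h : ∀ j, ∃ n : ℕ, ∀ (ω : ℂ) (y : V → ℂ), (∀ i j, 0 < A i j → y j = ω * y i) →
      y j = ω ^ n * y v := by
    intro j
    induction hirr v j with
    | refl => exact ⟨0, by simp⟩
    | tail _ hab ih =>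
      obtain ⟨n, hn⟩ := ih
      refine ⟨n + 1, fun ω y hy => ?_⟩
      rw [hy _ _ hab, hn ω y hy, pow_succ', mul_assoc]
  choose n hn using h
  exact ⟨n, fun ω y hy j => hn j ω y hy⟩

theorem mem_phaseGroup_of_ne_zero {V : Type*} {A : Matrix V V ℝ} (hirr : ∀ i j, Reach A i j)
    {ω : ℂˣ} {y : V → ℂ} (hy : ∀ i j, 0 < A i j → y j = ω * y i) {v : V} (hv : y v ≠ 0) :
    ω ∈ phaseGroup A := by
  obtain ⟨n, hn⟩ := exists_level hirr v
  have hne : ∀ j, y j ≠ 0 := fun j => by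
    rw [hn ω y hy j]
    exact mul_ne_zero (pow_ne_zero _ ω.ne_zero) hv
  exact ⟨fun j => Units.mk0 (y j) (hne j), fun i j h => Units.ext (hy i j h)⟩

section

variable [Nonempty V] {A : Matrix V V ℝ} (hA : ∀ i j, 0 ≤ A i j) (hirr : ∀ i j, Reach A i j)
  (hρ : 0 < specRad A)

include hA hirr

/-- Multiplying the Perron vector by a function of phase `ω` gives an eigenvector for `ρ ω`. -/
theorem mul_mem_spectrum_of_mem_phaseGroup {ω : ℂˣ} (hω : ω ∈ phaseGroup A) :
    (specRad A * ω : ℂ) ∈ spectrum ℂ (A.map (algebraMap ℝ ℂ)) := by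
  obtain ⟨x, hx, hAx⟩ := exists_perron_vector hA hirr
  obtain ⟨u, hu⟩ := hω
  refine (mem_spectrum_iff_exists_mulVec _ _).2 ⟨fun i => u i * x i, ?_, funext fun i => ?_⟩
  · obtain ⟨v⟩ := ‹Nonempty V›
    exact Function.ne_iff.2 ⟨v, mul_ne_zero (u v).ne_zero (by exact_mod_cast (hx v).ne')⟩
  · have h1 : ∑ j, A i j * x j = specRad A * x i := congrFun hAx i
    have h2 : ∀ j, (A i j : ℂ) * (u j * x j) = (ω * u i) * ((A i j * x j : ℝ) : ℂ) := by
      intro j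
      rcases (hA i j).eq_or_lt with h | h
      · simp [← h]
      · rw [hu i j h]; push_cast; ring
    simp only [Matrix.mulVec, dotProduct, Matrix.map_apply, Pi.smul_apply, smul_eq_mul,
      Complex.coe_algebraMap, h2]
    rw [← Finset.mul_sum, ← Complex.ofReal_sum, h1]
    push_cast; ring

include hρ

theorem norm_eq_one_of_mem_phaseGroup {ω : ℂˣ} (hω : ω ∈ phaseGroup A) : ‖(ω : ℂ)‖ = 1 := by
  have key : ∀ ω ∈ phaseGroup A, ‖(ω : ℂ)‖ ≤ 1 := by
    intro ω hω
    have h := norm_le_of_mem_spectrum _ (mul_mem_spectrum_of_mem_phaseGroup hA hirr hω)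
    rw [norm_mul, Complex.norm_real, Real.norm_of_nonneg hρ.le] at h
    exact le_of_mul_le_mul_left (h.trans_eq (mul_one (specRad A)).symm) hρ
  refine le_antisymm (key ω hω) ?_
  have h := key _ (inv_mem hω)
  rw [Units.val_inv_eq_inv_val, norm_inv] at h
  exact (inv_le_one₀ (norm_pos_iff.2 ω.ne_zero)).1 h

/-- The eigenvalues of maximal modulus are the multiples by `ρ` of the peripheral phases. -/
theorem peripheral_eq_image :
    {z : ℂ | z ∈ spectrum ℂ (A.map (algebraMap ℝ ℂ)) ∧ ‖z‖ = specRad A} =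
      (fun ω : ℂˣ => (specRad A * ω : ℂ)) '' (phaseGroup A : Set ℂˣ) := by
  ext z
  constructor
  · rintro ⟨hz, hzn⟩
    obtain ⟨x, hx, hAx⟩ := exists_perron_vector hA hirr
    obtain ⟨w, hw0, hw⟩ := (mem_spectrum_iff_exists_mulVec _ _).1 hz
    have hz0 : z ≠ 0 := norm_ne_zero_iff.1 (hzn ▸ hρ.ne')
    have hρ0 : (specRad A : ℂ) ≠ 0 := by exact_mod_cast hρ.ne'
    have hzeq : (specRad A : ℂ) * (z / specRad A) = z := mul_div_cancel₀ z hρ0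
    obtain ⟨v, hv⟩ := Function.ne_iff.1 hw0
    refine ⟨Units.mk0 (z / specRad A) (div_ne_zero hz0 hρ0), ?_, hzeq⟩
    refine mem_phaseGroup_of_ne_zero hirr (y := fun i => w i / x i) (v := v) (fun i j hij => ?_)
      (div_ne_zero hv (by exact_mod_cast (hx v).ne'))
    refine phase_of_mulVec_eq hA hirr hρ hx hAx ?_ (by rwa [Units.val_mk0, hzeq]) hij
    rw [Units.val_mk0, norm_div, hzn, Complex.norm_real, Real.norm_of_nonneg hρ.le,
      div_self hρ.ne']
  · rintro ⟨ω, hω, rfl⟩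
    refine ⟨mul_mem_spectrum_of_mem_phaseGroup hA hirr hω, ?_⟩
    rw [norm_mul, norm_eq_one_of_mem_phaseGroup hA hirr hρ hω, mul_one, Complex.norm_real,
      Real.norm_of_nonneg hρ.le]

omit [Nonempty V] hA hirr in
theorem mul_units_injective : Function.Injective fun ω : ℂˣ => (specRad A * ω : ℂ) := by
  intro a b h
  have hρ0 : (specRad A : ℂ) ≠ 0 := by exact_mod_cast hρ.ne'
  exact Units.ext (mul_left_cancel₀ hρ0 h)

theorem finite_phaseGroup : Finite (phaseGroup A) := by
  have h : ((fun ω : ℂˣ => (specRad A * ω : ℂ)) '' (phaseGroup A : Set ℂˣ)).Finite := by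
    rw [← peripheral_eq_image hA hirr hρ]
    exact (Matrix.finite_spectrum _).subset fun z hz => hz.1
  exact (h.of_finite_image (mul_units_injective hρ).injOn).to_subtype

theorem ncard_peripheral_eq_card_phaseGroup :
    {z : ℂ | z ∈ spectrum ℂ (A.map (algebraMap ℝ ℂ)) ∧ ‖z‖ = specRad A}.ncard =
      Nat.card (phaseGroup A) := by
  rw [peripheral_eq_image hA hirr hρ,
    Set.ncard_image_of_injective _ (mul_units_injective hρ)]
  rfl

/-- A finite group of units of `ℂ` of order `h` is the group of all `h`-th roots of unity. -/
theorem phaseGroup_eq_rootsOfUnity :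
    phaseGroup A = rootsOfUnity (Nat.card (phaseGroup A)) ℂ := by
  have := finite_phaseGroup hA hirr hρ
  have : NeZero (Nat.card (phaseGroup A)) := ⟨Nat.card_pos.ne'⟩
  refine Subgroup.eq_of_le_of_card_ge (fun ω hω => ?_) (Complex.card_rootsOfUnity _).le
  rw [mem_rootsOfUnity]
  exact congrArg Subtype.val (pow_card_eq_one' (x := (⟨ω, hω⟩ : phaseGroup A)))

/-! ### Eigenvectors of a power of an irreducible matrix -/

/-- If `A ^ (N + 1) d = ρ ^ (N + 1) d` and `r` is the greatest common divisor of `N + 1` and the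
number of peripheral phases, then `d` divided by the Perron vector is constant on the classes of
an `r`-cyclic partition. The partition comes from a primitive `r`-th root of unity, which is a
peripheral phase. For the constancy, `d` is the average of the vectors
`∑_{l ≤ N} (ρ ω)⁻ˡ A ^ l d` over the `(N + 1)`-th roots of unity `ω`; each of them is zero or an
eigenvector for `ρ ω`, and in the latter case `ω ^ r = 1`. -/
theorem exists_cyclic_map_of_pow_mulVec_eq (hrow : ∀ i, ∃ j, 0 < A i j) {x : V → ℝ}
    (hx : ∀ i, 0 < x i) (hAx : A.mulVec x = specRad A • x) {N : ℕ} {d : V → ℝ}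
    (hd : (A ^ (N + 1)).mulVec d = specRad A ^ (N + 1) • d) :
    ∃ m : V → ZMod (Nat.gcd (N + 1) (Nat.card (phaseGroup A))),
      Function.Surjective m ∧ (∀ i j, 0 < A i j → m j = m i + 1) ∧
        ∀ i j, m i = m j → d i / x i = d j / x j := by
  set h := Nat.card (phaseGroup A) with hh
  set r := Nat.gcd (N + 1) h with hr
  have hr0 : r ≠ 0 := (Nat.gcd_pos_of_pos_left _ N.succ_pos).ne'
  have : NeZero r := ⟨hr0⟩
  obtain ⟨v⟩ := ‹Nonempty V›
  have : Nonempty V := ⟨v⟩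
  obtain ⟨n, hn⟩ := exists_level hirr v
  have hroots := phaseGroup_eq_rootsOfUnity hA hirr hρ
  rw [← hh] at hroots
  refine ⟨fun i => (n i : ZMod r), ?_⟩
  -- A primitive `r`-th root of unity is a peripheral phase, so `n` modulo `r` counts arcs.
  have hstep : ∀ i j, 0 < A i j → (n j : ZMod r) = n i + 1 := by
    intro i j hij
    have hζ := Complex.isPrimitiveRoot_exp r hr0
    set ζ := Complex.exp (2 * Real.pi * Complex.I / r)
    have hmem : (hζ.isUnit hr0).unit ∈ phaseGroup A := by
      rw [hroots, mem_rootsOfUnity]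
      ext
      simpa using (hζ.pow_eq_one_iff_dvd h).2 (Nat.gcd_dvd_right _ _)
    obtain ⟨u, hu⟩ := hmem
    have hu' : ∀ i j, 0 < A i j → (u j : ℂ) = ζ * u i := fun i j h => by
      simp [hu i j h]
    have h1 := hn ζ (fun i => u i) hu'
    have h2 := hu' i j hij
    rw [h1 i, h1 j, ← mul_assoc, ← pow_succ'] at h2
    have h3 := mul_right_cancel₀ (u v).ne_zero h2
    have h4 : (hζ.isUnit hr0).unit ^ n j = (hζ.isUnit hr0).unit ^ (n i + 1) :=
      Units.ext (by simpa using h3)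
    rw [pow_eq_pow_iff_modEq, ← (hζ.isUnit_unit hr0).eq_orderOf,
      ← ZMod.natCast_eq_natCast_iff] at h4
    simpa using h4
  refine ⟨fun a => ?_, hstep, fun i j hij => ?_⟩
  -- Every row has a positive entry, so walks from `v` of all lengths exist.
  · have hall : ∀ t : ℕ, ∃ i, (n i : ZMod r) = n v + t := by
      intro t
      induction t with
      | zero => exact ⟨v, by simp⟩
      | succ t ih =>
        obtain ⟨i, hi⟩ := ih
        obtain ⟨j, hj⟩ := hrow i
        exact ⟨j, by rw [hstep i j hj, hi]; push_cast; ring⟩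
    obtain ⟨i, hi⟩ := hall (a - n v).val
    exact ⟨i, by simp only [hi, ZMod.natCast_zmod_val]; ring⟩
  · set ρ := specRad A
    -- The vector `z t` is the component of `d` for the eigenvalue `ρ η ^ t`, times `N + 1`.
    have hρ0 : (ρ : ℂ) ≠ 0 := by exact_mod_cast hρ.ne'
    set M := A.map (algebraMap ℝ ℂ) with hM
    set D : V → ℂ := fun i => (d i : ℂ) with hD
    have hMD : (M ^ (N + 1)).mulVec D = (ρ : ℂ) ^ (N + 1) • D := by
      rw [hM, ← Matrix.map_pow, hD, map_mulVec_ofReal, hd]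
      ext i; simp
    have hη := Complex.isPrimitiveRoot_exp (N + 1) N.succ_ne_zero
    set η := Complex.exp (2 * Real.pi * Complex.I / ((N + 1 : ℕ) : ℂ))
    have hη0 : η ≠ 0 := hη.ne_zero N.succ_ne_zero
    set z : ℕ → V → ℂ := fun t =>
      ∑ l ∈ Finset.range (N + 1), ((ρ * η ^ t)⁻¹) ^ l • (M ^ l).mulVec D with hz
    have hzeig : ∀ t, M.mulVec (z t) = (ρ * η ^ t) • z t := by
      intro t
      have hμ : ρ * η ^ t ≠ 0 := mul_ne_zero hρ0 (pow_ne_zero _ hη0)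
      have hpow : (ρ * η ^ t) ^ (N + 1) = (ρ : ℂ) ^ (N + 1) := by
        rw [mul_pow, ← pow_mul, mul_comm t, pow_mul, hη.pow_eq_one, one_pow, mul_one]
      rw [hz, mulVec_sum_inv_pow_smul M hμ, hMD, smul_smul, ← hpow, ← mul_pow,
        inv_mul_cancel₀ hμ, one_pow, one_smul, sub_add_cancel]
    have hzconst : ∀ t, z t i / x i = z t j / x j := by
      intro t
      have hy : ∀ a b, 0 < A a b → z t b / x b = η ^ t * (z t a / x a) := fun a b hab =>
        phase_of_mulVec_eq hA hirr hρ hx hAx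
          (by rw [norm_pow, hη.norm'_eq_one N.succ_ne_zero, one_pow]) (hzeig t) hab
      have hlev := hn (η ^ t) (fun a => z t a / x a) hy
      by_cases hv : z t v / x v = 0
      · rw [hlev i, hlev j, hv, mul_zero, mul_zero]
      · have hmem := mem_phaseGroup_of_ne_zero hirr (ω := Units.mk0 (η ^ t) (pow_ne_zero _ hη0))
          (y := fun a => z t a / x a) hy hv
        rw [hroots, mem_rootsOfUnity] at hmem
        have hωh : (η ^ t) ^ h = 1 := by simpa using congrArg Units.val hmem
        have hωN : (η ^ t) ^ (N + 1) = 1 := by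
          rw [← pow_mul, mul_comm t, pow_mul, hη.pow_eq_one, one_pow]
        have hωr : (η ^ t) ^ r = 1 := pow_gcd_eq_one.2 ⟨hωN, hωh⟩
        rw [hlev i, hlev j,
          pow_eq_pow_of_modEq ((ZMod.natCast_eq_natCast_iff _ _ _).1 hij) hωr]
    have hsum : ∀ a, ∑ t ∈ Finset.range (N + 1), z t a = (N + 1) * D a := by
      intro a
      simp only [hz, Finset.sum_apply, Pi.smul_apply, smul_eq_mul]
      rw [sum_sum_inv_pow_mul hη N.succ_pos ρ fun l => (M ^ l).mulVec D a]
      simp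
    have hfin : (N + 1) * (D i / x i) = (N + 1) * (D j / x j) := by
      rw [← mul_div_assoc, ← mul_div_assoc, ← hsum, ← hsum, Finset.sum_div, Finset.sum_div]
      exact Finset.sum_congr rfl fun t _ => hzconst t
    have hN0 : ((N : ℂ) + 1) ≠ 0 := by exact_mod_cast N.succ_ne_zero
    have := mul_left_cancel₀ hN0 hfin
    simp only [hD] at this
    exact_mod_cast this

end

/-! ### Walk counts and arc values -/

variable [Quiver V] [∀ i j : V, Fintype (i ⟶ j)]

omit [Fintype V] [DecidableEq V] in
theorem adjMatrix_nonneg (i j : V) : 0 ≤ adjMatrix ℝ V i j := by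
  simp [adjMatrix]

omit [Fintype V] [DecidableEq V] in
theorem adjMatrix_pos_iff {i j : V} : 0 < adjMatrix ℝ V i j ↔ Nonempty (i ⟶ j) := by
  simp [adjMatrix, Fintype.card_pos_iff]

omit [Fintype V] [DecidableEq V] in
theorem adjMatrix_map_algebraMap : (adjMatrix ℝ V).map (algebraMap ℝ ℂ) = adjMatrix ℂ V := by
  ext i j; simp [adjMatrix]

theorem rho_eq_specRad : rho V = specRad (adjMatrix ℝ V) := by
  rw [rho, specRad, adjMatrix_map_algebraMap]

omit [Fintype V] [DecidableEq V] in
theorem reach_of_isStronglyConnected (h : Quiver.IsStronglyConnected V) (i j : V) :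
    Reach (adjMatrix ℝ V) i j := by
  obtain ⟨p⟩ := h i j
  induction p with
  | nil => exact .refl
  | cons _ e ih => exact ih.tail (adjMatrix_pos_iff.2 ⟨e⟩)

/-- The `k`-outdegrees as a real vector. -/
noncomputable def outdeg (V : Type*) [Fintype V] [DecidableEq V] [Quiver V]
    [∀ i j : V, Fintype (i ⟶ j)] (k : ℕ) : V → ℝ :=
  fun i => kOutdegree k i

theorem outdeg_eq_mulVec (k : ℕ) : outdeg V k = (adjMatrix ℝ V ^ k).mulVec 1 := by
  have h : adjMatrix ℝ V = (adjMatrix ℕ V).map (Nat.castRingHom ℝ) := by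
    ext i j; simp [adjMatrix]
  ext i
  rw [h, ← Matrix.map_pow]
  simp [outdeg, kOutdegree, Matrix.mulVec, dotProduct]

theorem pow_mulVec_outdeg (k n : ℕ) :
    (adjMatrix ℝ V ^ n).mulVec (outdeg V k) = outdeg V (k + n) := by
  rw [outdeg_eq_mulVec, outdeg_eq_mulVec, Matrix.mulVec_mulVec, ← pow_add, add_comm]

theorem mulVec_outdeg (k : ℕ) : (adjMatrix ℝ V).mulVec (outdeg V k) = outdeg V (k + 1) := by
  simpa using pow_mulVec_outdeg (V := V) k 1

theorem sum_adjMatrix_mul (n : ℕ) (t : ℝ) (i : V) :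
    ∑ j, adjMatrix ℝ V i j * (t * outdeg V n j) = t * outdeg V (n + 1) i := by
  rw [← mulVec_outdeg, Matrix.mulVec, dotProduct, Finset.mul_sum]
  exact Finset.sum_congr rfl fun j _ => mul_left_comm _ _ _

omit [Fintype V] [DecidableEq V] [∀ i j : V, Fintype (i ⟶ j)] in
theorem exists_arc (hsink : ∀ i : V, ¬ IsSink i) (i : V) : ∃ j, Nonempty (i ⟶ j) := by
  simpa [IsSink] using hsink i

theorem outdeg_pos (hsink : ∀ i : V, ¬ IsSink i) (k : ℕ) (i : V) : 0 < outdeg V k i := by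
  induction k generalizing i with
  | zero => simp [outdeg_eq_mulVec]
  | succ k ih =>
    obtain ⟨j, hj⟩ := exists_arc hsink i
    rw [← mulVec_outdeg]
    exact Finset.sum_pos' (fun l _ => mul_nonneg (adjMatrix_nonneg i l) (ih l).le)
      ⟨j, Finset.mem_univ j, mul_pos (adjMatrix_pos_iff.2 hj) (ih j)⟩

/-- Without sinks, `A` does not decrease the all-ones vector, so that `ρ ≥ 1`. -/
theorem rho_pos [Nonempty V] (hsink : ∀ i : V, ¬ IsSink i) : 0 < rho V := by
  obtain ⟨v⟩ := ‹Nonempty V›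
  rw [rho_eq_specRad]
  refine zero_lt_one.trans_le (le_spectralRadius_of_le_mulVec adjMatrix_nonneg
    (outdeg_pos hsink 0 v) zero_le_one fun j => ?_)
  rw [mulVec_outdeg, one_mul]
  have h1 : outdeg V 0 j = 1 := by simp [outdeg_eq_mulVec]
  have h2 := outdeg_pos hsink 1 j
  rw [h1]
  simp only [outdeg, Nat.cast_pos] at h2
  exact Nat.one_le_cast.2 h2

theorem finite_arcValues (k N : ℕ) : (arcValues V k N).Finite := by
  refine (Set.finite_range fun p : V × V =>
    (outdeg V (k + 1) p.1 * outdeg V (k + N) p.2 / (outdeg V k p.1 * outdeg V k p.2)) ^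
      (1 / ((N : ℝ) + 1))).subset ?_
  rintro _ ⟨i, j, -, rfl⟩
  exact ⟨(i, j), rfl⟩

theorem nonempty_arcValues [Nonempty V] (hsink : ∀ i : V, ¬ IsSink i) (k N : ℕ) :
    (arcValues V k N).Nonempty := by
  obtain ⟨v⟩ := ‹Nonempty V›
  obtain ⟨j, hj⟩ := exists_arc hsink v
  exact ⟨_, v, j, hj, rfl⟩

theorem arcValues_nonneg {k N : ℕ} {y : ℝ} (hy : y ∈ arcValues V k N) : 0 ≤ y := by
  obtain ⟨i, j, -, rfl⟩ := hy
  positivity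

theorem rpow_one_div_pow {a : ℝ} (ha : 0 ≤ a) (N : ℕ) :
    (a ^ (1 / ((N : ℝ) + 1))) ^ (N + 1) = a := by
  have := Real.rpow_inv_natCast_pow ha N.succ_ne_zero
  simpa [one_div] using this

/-- Summing the arc-wise lower bound over the arcs leaving a vertex bounds `A ^ (N + 1)` on the
`k`-outdegrees from below. -/
theorem pow_mul_outdeg_le (hsink : ∀ i : V, ¬ IsSink i) {k N : ℕ} {m : ℝ} (hm : 0 ≤ m)
    (h : ∀ y ∈ arcValues V k N, m ≤ y) (i : V) :
    m ^ (N + 1) * outdeg V k i ≤ (adjMatrix ℝ V ^ (N + 1)).mulVec (outdeg V k) i := by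
  have hd := outdeg_pos hsink
  rw [pow_mulVec_outdeg]
  have hterm : ∀ j, adjMatrix ℝ V i j * (m ^ (N + 1) * outdeg V k i * outdeg V k j) ≤
      adjMatrix ℝ V i j * (outdeg V (k + 1) i * outdeg V (k + N) j) := by
    intro j
    rcases (adjMatrix_nonneg i j).eq_or_lt with h0 | h0
    · simp [← h0]
    refine mul_le_mul_of_nonneg_left ?_ h0.le
    have h1 := pow_le_pow_left₀ hm (h _ ⟨i, j, adjMatrix_pos_iff.1 h0, rfl⟩) (N + 1)
    rw [rpow_one_div_pow (by positivity)] at h1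
    rw [mul_assoc]
    exact (le_div_iff₀ (mul_pos (hd k i) (hd k j))).1 h1
  have hsum := Finset.sum_le_sum fun j (_ : j ∈ Finset.univ) => hterm j
  rw [sum_adjMatrix_mul, sum_adjMatrix_mul, add_assoc, mul_comm (outdeg V (k + 1) i)] at hsum
  exact le_of_mul_le_mul_right hsum (hd _ i)

theorem pow_mulVec_outdeg_le (hsink : ∀ i : V, ¬ IsSink i) {k N : ℕ} {m : ℝ}
    (h : ∀ y ∈ arcValues V k N, y ≤ m) (i : V) :
    (adjMatrix ℝ V ^ (N + 1)).mulVec (outdeg V k) i ≤ m ^ (N + 1) * outdeg V k i := by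
  have hd := outdeg_pos hsink
  rw [pow_mulVec_outdeg]
  have hterm : ∀ j, adjMatrix ℝ V i j * (outdeg V (k + 1) i * outdeg V (k + N) j) ≤
      adjMatrix ℝ V i j * (m ^ (N + 1) * outdeg V k i * outdeg V k j) := by
    intro j
    rcases (adjMatrix_nonneg i j).eq_or_lt with h0 | h0
    · simp [← h0]
    refine mul_le_mul_of_nonneg_left ?_ h0.le
    have hmem : _ ∈ arcValues V k N := ⟨i, j, adjMatrix_pos_iff.1 h0, rfl⟩
    have h1 := pow_le_pow_left₀ (arcValues_nonneg hmem) (h _ hmem) (N + 1)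
    rw [rpow_one_div_pow (by positivity)] at h1
    rw [mul_assoc]
    exact (div_le_iff₀ (mul_pos (hd k i) (hd k j))).1 h1
  have hsum := Finset.sum_le_sum fun j (_ : j ∈ Finset.univ) => hterm j
  rw [sum_adjMatrix_mul, sum_adjMatrix_mul, add_assoc, mul_comm (outdeg V (k + 1) i)] at hsum
  exact le_of_mul_le_mul_right hsum (hd _ i)

theorem le_rho_of_le_arcValues [Nonempty V] (hsink : ∀ i : V, ¬ IsSink i) {k N : ℕ} {m : ℝ}
    (hm : 0 ≤ m) (h : ∀ y ∈ arcValues V k N, m ≤ y) : m ≤ rho V := by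
  obtain ⟨v⟩ := ‹Nonempty V›
  have : Nonempty V := ⟨v⟩
  have h1 := le_spectralRadius_of_le_mulVec (C := adjMatrix ℝ V ^ (N + 1))
    (fun i j => Matrix.pow_apply_nonneg adjMatrix_nonneg _ i j) (outdeg_pos hsink k v)
    (by positivity) (pow_mul_outdeg_le hsink hm h)
  rw [← specRad, specRad_pow _ N.succ_pos, ← rho_eq_specRad] at h1
  exact (pow_le_pow_iff_left₀ hm (rho_pos hsink).le N.succ_ne_zero).1 h1

theorem rho_le_of_arcValues_le [Nonempty V] (hsink : ∀ i : V, ¬ IsSink i) {k N : ℕ} {m : ℝ}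
    (hm : 0 ≤ m) (h : ∀ y ∈ arcValues V k N, y ≤ m) : rho V ≤ m := by
  have h1 := spectralRadius_le_of_mulVec_le (C := adjMatrix ℝ V ^ (N + 1))
    (fun i j => Matrix.pow_apply_nonneg adjMatrix_nonneg _ i j) (outdeg_pos hsink k)
    (pow_mulVec_outdeg_le hsink h)
  rw [← specRad, specRad_pow _ N.succ_pos, ← rho_eq_specRad] at h1
  exact (pow_le_pow_iff_left₀ (rho_pos hsink).le hm N.succ_ne_zero).1 h1

/-! ### The case of equality -/

/-- There is a cyclic partition into `r` classes on each of which the average `(k + 1)`-outdegree is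
constant. In contrast to quasiregularity, `r = 1` is allowed; this is average regularity. -/
def HasCyclicAvgOutdegree (V : Type*) [Fintype V] [DecidableEq V] [Quiver V]
    [∀ i j : V, Fintype (i ⟶ j)] (k r : ℕ) : Prop :=
  ∃ m : V → ZMod r, IsCyclicPartition r m ∧
    ∃ c : ZMod r → ℝ, ∀ i : V, outdeg V (k + 1) i / outdeg V k i = c (m i)

theorem HasCyclicAvgOutdegree.regular_or_quasiregular {k r : ℕ} (hr : 0 < r)
    (hdvd : r ∣ imprimitivityIndex V) (h : HasCyclicAvgOutdegree V k r) :
    IsAvgOutdegreeRegular V (k + 1) ∨ IsAvgOutdegreeQuasiregular V (k + 1) r := by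
  obtain ⟨m, hm, c, hc⟩ := h
  obtain rfl | hr1 : r = 1 ∨ 1 < r := by lia
  · exact Or.inl ⟨by lia, c 0, fun i => (hc i).trans (by rw [Subsingleton.elim (m i) 0])⟩
  · exact Or.inr ⟨by lia, ⟨hr1, hdvd⟩, m, hm, c, hc⟩

/-- If the average outdegrees are constant on cyclic classes, lengthening the walks by `n`
multiplies their number by the constants of the `n` consecutive classes passed first. -/
theorem outdeg_add_eq_prod {k r : ℕ} (hsink : ∀ i : V, ¬ IsSink i) {m : V → ZMod r}
    (hm : ∀ i j : V, Nonempty (i ⟶ j) → m j = m i + 1) {c : ZMod r → ℝ}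
    (hc : ∀ i : V, outdeg V (k + 1) i / outdeg V k i = c (m i)) (n : ℕ) (i : V) :
    outdeg V (k + n) i = (∏ l ∈ Finset.range n, c (m i + l)) * outdeg V k i := by
  induction n generalizing i with
  | zero => simp
  | succ n ih =>
    have h1 : outdeg V (k + 1) i = c (m i) * outdeg V k i := by
      rw [← hc, div_mul_cancel₀ _ (outdeg_pos hsink k i).ne']
    rw [← add_assoc, ← mulVec_outdeg, Finset.prod_range_succ', Nat.cast_zero, add_zero, mul_assoc,
      ← h1, ← mulVec_outdeg]
    simp only [Matrix.mulVec, dotProduct, Finset.mul_sum]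
    refine Finset.sum_congr rfl fun j _ => ?_
    rcases (adjMatrix_nonneg i j).eq_or_lt with h0 | h0
    · simp [← h0]
    · rw [ih, hm i j (adjMatrix_pos_iff.1 h0)]
      simp only [Nat.cast_succ, add_assoc, add_comm (1 : ZMod r)]
      ring

/-- Each arc value is the `(N + 1)`-th root of a product of `N + 1` cyclically consecutive
constants, and such products do not depend on the starting class when `r ∣ N + 1`. -/
theorem arcValues_subsingleton {k N r : ℕ} (hsink : ∀ i : V, ¬ IsSink i) (hr : r ∣ N + 1)
    (h : HasCyclicAvgOutdegree V k r) : (arcValues V k N).Subsingleton := by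
  obtain ⟨m, ⟨-, hm⟩, c, hc⟩ := h
  have : NeZero r := ⟨fun h0 => by simp [h0] at hr⟩
  set p : ZMod r → ℝ := fun a => ∏ l ∈ Finset.range (N + 1), c (a + l) with hp
  have hshift : ∀ a, p (a + 1) = p a := by
    intro a
    -- The two products share `N` factors; the remaining ones are `c (a + (N + 1))` and `c a`.
    have hN : ((N : ZMod r) + 1) = 0 := by
      exact_mod_cast (ZMod.natCast_eq_zero_iff (N + 1) r).2 hr
    simp only [hp]
    rw [Finset.prod_range_succ, Finset.prod_range_succ']
    simp only [Nat.cast_succ, Nat.cast_zero, add_assoc, add_comm (1 : ZMod r), hN]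
  have hconst : ∀ a, p a = p 0 := by
    intro a
    rw [← ZMod.natCast_zmod_val a]
    induction a.val with
    | zero => simp
    | succ t ih => rw [Nat.cast_succ, hshift, ih]
  have hval : ∀ i j : V, Nonempty (i ⟶ j) →
      outdeg V (k + 1) i * outdeg V (k + N) j / (outdeg V k i * outdeg V k j) = p 0 := by
    intro i j hij
    rw [outdeg_add_eq_prod hsink hm hc N j, mul_div_mul_comm, hc,
      mul_div_cancel_right₀ _ (outdeg_pos hsink k j).ne', ← hconst (m i), hm i j hij]
    simp only [hp]
    rw [Finset.prod_range_succ']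
    simp only [Nat.cast_succ, Nat.cast_zero, add_zero, add_assoc, add_comm (1 : ZMod r)]
    exact mul_comm _ _
  rintro _ ⟨i, j, hij, rfl⟩ _ ⟨i', j', hij', rfl⟩
  have h1 := hval i j hij
  have h2 := hval i' j' hij'
  simp only [outdeg] at h1 h2
  rw [h1, h2]

theorem arcValues_subsingleton_of_regular_or_quasiregular [Nonempty V] {k N r : ℕ}
    (hsink : ∀ i : V, ¬ IsSink i) (hr : r ∣ N + 1)
    (h : IsAvgOutdegreeRegular V (k + 1) ∨ IsAvgOutdegreeQuasiregular V (k + 1) r) :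
    (arcValues V k N).Subsingleton := by
  rcases h with ⟨-, c, hc⟩ | ⟨-, -, m, hm, c, hc⟩
  · refine arcValues_subsingleton hsink (one_dvd _)
      ⟨fun _ => 0, ⟨fun a => ?_, fun _ _ _ => Subsingleton.elim _ _⟩, fun _ => c, hc⟩
    exact ⟨Classical.arbitrary V, Subsingleton.elim _ _⟩
  · exact arcValues_subsingleton hsink hr ⟨m, hm, c, hc⟩

/-- If the `k`-outdegrees form an eigenvector of `A ^ (N + 1)`, then on each class of the cyclic
partition they are proportional to the Perron vector, and so are the `(k + 1)`-outdegrees. -/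
theorem hasCyclicAvgOutdegree_of_pow_mulVec_eq [Nonempty V] (hsink : ∀ i : V, ¬ IsSink i)
    (hsc : Quiver.IsStronglyConnected V) {k N : ℕ}
    (h : (adjMatrix ℝ V ^ (N + 1)).mulVec (outdeg V k) = rho V ^ (N + 1) • outdeg V k) :
    HasCyclicAvgOutdegree V k (Nat.gcd (N + 1) (imprimitivityIndex V)) := by
  have hirr := reach_of_isStronglyConnected hsc
  have hρ := rho_pos hsink
  have himp : imprimitivityIndex V = Nat.card (phaseGroup (adjMatrix ℝ V)) := by
    rw [rho_eq_specRad] at hρ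
    rw [← ncard_peripheral_eq_card_phaseGroup adjMatrix_nonneg hirr hρ, imprimitivityIndex,
      rho_eq_specRad, adjMatrix_map_algebraMap]
  obtain ⟨x, hx, hAx⟩ := exists_perron_vector (adjMatrix_nonneg (V := V)) hirr
  rw [rho_eq_specRad] at hρ h
  obtain ⟨m, hsurj, hm, hd⟩ := exists_cyclic_map_of_pow_mulVec_eq adjMatrix_nonneg hirr hρ
    (fun i => (exists_arc hsink i).imp fun j hj => adjMatrix_pos_iff.2 hj) hx hAx h
  rw [himp]
  refine ⟨m, ⟨hsurj, fun i j hij => hm i j (adjMatrix_pos_iff.2 hij)⟩, ?_⟩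
  -- `F a` is the common value of `d / x` on the class `a`.
  set s := Function.surjInv hsurj
  set F : ZMod _ → ℝ := fun a => outdeg V k (s a) / x (s a)
  have hdF : ∀ i, outdeg V k i = F (m i) * x i := fun i => by
    rw [← div_eq_iff (hx i).ne']
    exact hd _ _ (Function.surjInv_eq hsurj (m i)).symm
  refine ⟨fun a => specRad (adjMatrix ℝ V) * F (a + 1) / F a, fun i => ?_⟩
  have h1 : outdeg V (k + 1) i = F (m i + 1) * (specRad (adjMatrix ℝ V) * x i) := by
    rw [← mulVec_outdeg, ← smul_eq_mul (specRad _), ← Pi.smul_apply, ← hAx]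
    simp only [Matrix.mulVec, dotProduct, Finset.mul_sum]
    refine Finset.sum_congr rfl fun j _ => ?_
    rcases (adjMatrix_nonneg i j).eq_or_lt with h0 | h0
    · simp [← h0]
    · rw [hdF, hm i j h0]; ring
  rw [h1, hdF i, ← mul_assoc, mul_div_mul_right _ _ (hx i).ne', mul_comm (F _)]

/-- Equality in either bound makes the `k`-outdegrees superharmonic or subharmonic, hence harmonic,
for `A ^ (N + 1)`. -/
theorem regular_or_quasiregular_of_rho_bound [Nonempty V] (hsink : ∀ i : V, ¬ IsSink i)
    (hsc : Quiver.IsStronglyConnected V) {k N : ℕ}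
    (h : (∀ y ∈ arcValues V k N, rho V ≤ y) ∨ ∀ y ∈ arcValues V k N, y ≤ rho V) :
    IsAvgOutdegreeRegular V (k + 1) ∨ IsAvgOutdegreeQuasiregular V (k + 1)
      (Nat.gcd (N + 1) (imprimitivityIndex V)) := by
  refine HasCyclicAvgOutdegree.regular_or_quasiregular (Nat.gcd_pos_of_pos_left _ N.succ_pos)
    (Nat.gcd_dvd_right _ _) (hasCyclicAvgOutdegree_of_pow_mulVec_eq hsink hsc ?_)
  have hirr := reach_of_isStronglyConnected hsc
  have hρ := rho_pos hsink
  obtain ⟨x, hx, hAx⟩ := exists_perron_vector (adjMatrix_nonneg (V := V)) hirr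
  rw [← rho_eq_specRad] at hAx
  rcases h with h | h
  -- In the subharmonic case `-d` is superharmonic.
  · have h1 := pow_mulVec_eq_of_le adjMatrix_nonneg hirr hρ hx hAx (d := -outdeg V k)
      (N := N) fun i => by
        rw [Matrix.mulVec_neg, Pi.neg_apply, Pi.neg_apply, mul_neg]
        exact neg_le_neg (pow_mul_outdeg_le hsink hρ.le h i)
    rwa [Matrix.mulVec_neg, smul_neg, neg_inj] at h1
  · exact pow_mulVec_eq_of_le adjMatrix_nonneg hirr hρ hx hAx (pow_mulVec_outdeg_le hsink h)

end MultiDigraph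

theorem mainTheorem1 {V : Type*} [Fintype V] [DecidableEq V] [Nonempty V] [Quiver V]
    [∀ i j : V, Fintype (i ⟶ j)] (hsink : ∀ i : V, ¬ MultiDigraph.IsSink i) (N k : ℕ) :
    ∃ lo hi : ℝ,
      IsLeast (MultiDigraph.arcValues V k N) lo ∧
      IsGreatest (MultiDigraph.arcValues V k N) hi ∧
      lo ≤ MultiDigraph.rho V ∧ MultiDigraph.rho V ≤ hi ∧
      (Quiver.IsStronglyConnected V →
        (lo = MultiDigraph.rho V ↔
          (MultiDigraph.IsAvgOutdegreeRegular V (k + 1) ∨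
            MultiDigraph.IsAvgOutdegreeQuasiregular V (k + 1)
              (Nat.gcd (N + 1) (MultiDigraph.imprimitivityIndex V)))) ∧
        (MultiDigraph.rho V = hi ↔
          (MultiDigraph.IsAvgOutdegreeRegular V (k + 1) ∨
            MultiDigraph.IsAvgOutdegreeQuasiregular V (k + 1)
              (Nat.gcd (N + 1) (MultiDigraph.imprimitivityIndex V))))) := by
  have hne := MultiDigraph.nonempty_arcValues hsink k N
  have hfin := MultiDigraph.finite_arcValues (V := V) k N
  obtain ⟨lo, hlo, hlo'⟩ := Set.exists_min_image _ id hfin hne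
  obtain ⟨hi, hhi, hhi'⟩ := Set.exists_max_image _ id hfin hne
  have h1 : lo ≤ MultiDigraph.rho V :=
    MultiDigraph.le_rho_of_le_arcValues hsink (MultiDigraph.arcValues_nonneg hlo) hlo'
  have h2 : MultiDigraph.rho V ≤ hi :=
    MultiDigraph.rho_le_of_arcValues_le hsink (MultiDigraph.arcValues_nonneg hhi) hhi'
  refine ⟨lo, hi, ⟨hlo, hlo'⟩, ⟨hhi, hhi'⟩, h1, h2, fun hsc => ?_⟩
  have hback := fun h => MultiDigraph.arcValues_subsingleton_of_regular_or_quasiregular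
    (k := k) hsink (Nat.gcd_dvd_left (N + 1) (MultiDigraph.imprimitivityIndex V)) h hlo hhi
  refine ⟨⟨fun h => ?_, fun h => le_antisymm h1 (h2.trans_eq (hback h).symm)⟩,
    ⟨fun h => ?_, fun h => le_antisymm h2 ((hback h).symm.trans_le h1)⟩⟩
  · exact MultiDigraph.regular_or_quasiregular_of_rho_bound hsink hsc (.inl (h ▸ hlo'))
  · exact MultiDigraph.regular_or_quasiregular_of_rho_bound hsink hsc (.inr (h ▸ hhi'))
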